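/- Let $n \ge 0$ be an integer and let $f:\mathbb{R}^n\to\mathbb{R}$ be a $C^2$ function which is norm-coercive, i.e. $f(x)\to+\infty$ as $\|x\|\to+\infty$. Let $H_f(x)$ denote the Hessian matrix of $f$ at $x$, let $\mathrm{Hess}^+(f)=\{x\in\mathbb{R}^n : H_f(x) \text{ is positive definite}\}$, and let $C(f)=\{x\in\mathbb{R}^n : df_x=0\}$ be the critical set of $f$. Assume that $\mathbb{R}^n\setminus \mathrm{Hess}^+(f)$ is bounded and nonempty and that $C(f)$ is bounded. Then the maxima $$h_{\max}(f)=\max\bigl(f|_{\mathbb{R}^n\setminus \mathrm{Hess}^+(f)}\bigr),\qquad \nu_{\max}(f)=\max\bigl(f|_{C(f)}\bigr)$$ exist (both are attained), and $h_{\max}(f)\ge \nu_{\max}(f)$. -/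

import Mathlib

open Filter

noncomputable section

/-- The Hessian matrix `H_f(x) = (∂²f/∂xᵢ∂xⱼ (x))ᵢⱼ` of `f : ℝⁿ → ℝ` at `x`. -/
def hessianMatrix {n : ℕ} (f : EuclideanSpace ℝ (Fin n) → ℝ) (x : EuclideanSpace ℝ (Fin n)) :
    Matrix (Fin n) (Fin n) ℝ :=
  Matrix.of fun i j =>
    fderiv ℝ (fun y => fderiv ℝ f y (EuclideanSpace.single j 1)) x (EuclideanSpace.single i 1)

/-- `Hess⁺(f)`: the set of points at which the Hessian matrix of `f` is positive definite. -/
def hessPos {n : ℕ} (f : EuclideanSpace ℝ (Fin n) → ℝ) : Set (EuclideanSpace ℝ (Fin n)) :=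
  {x | (hessianMatrix f x).PosDef}

/-- `C(f)`: the set of critical points of `f`. -/
def criticalSet {n : ℕ} (f : EuclideanSpace ℝ (Fin n) → ℝ) : Set (EuclideanSpace ℝ (Fin n)) :=
  {x | fderiv ℝ f x = 0}

/-- `f` is norm-coercive: `f x → +∞` as `‖x‖ → +∞`. -/
def NormCoercive {n : ℕ} (f : EuclideanSpace ℝ (Fin n) → ℝ) : Prop :=
  Tendsto f (comap (fun x => ‖x‖) atTop) atTop

/-- `h_max(f)`: the maximum of `f` on the complement of `Hess⁺(f)`
(it is the maximum as soon as the latter is attained). -/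
def hMax {n : ℕ} (f : EuclideanSpace ℝ (Fin n) → ℝ) : ℝ :=
  sSup (f '' (hessPos f)ᶜ)

/-- `ν_max(f)`: the maximum of `f` on the critical set `C(f)`
(it is the maximum as soon as the latter is attained). -/
def nuMax {n : ℕ} (f : EuclideanSpace ℝ (Fin n) → ℝ) : ℝ :=
  sSup (f '' criticalSet f)

end

/-!
A critical point `p` whose value lies strictly above `h_max(f)` is impossible, by a mountain pass
argument that uses convexity of `f` near high points instead of a gradient flow.

Above the level `h_max(f)` every point has a positive definite Hessian, so `f` is strictly convex
in a ball around it. Hence such a `p` is a strict local minimum, isolated by a mountain ring from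
any `q` outside `Hess⁺(f)`, which has `f q < f p`. Let `c` be the infimum of the levels at which `p`
and `q` are joined inside the open sublevel set `{f < c}`; the ring gives `f p < c`.

* The infimum is not attained (`JoinedIn.exists_sublevel_lt`): a path has compact image, so `f` has
  a maximum smaller than `c` on it.
* The infimum is attained (`joinedIn_sublevel_of_forall_gt`): near a point at level `c` the set
  `{f < c}` is convex, so no such point touches two components of `{f < c}`. Thus the closure of the
  component of `p` is open and closed in the compact set `{f ≤ c}`, and the resulting separation
  persists to levels slightly above `c`.

The existence of the maxima is compactness: the complement of `Hess⁺(f)` and `C(f)` are closed, and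
`C(f)` contains a global minimum of `f`.
-/

section

open Set Metric Topology

/-! ### Connecting points inside sublevel sets -/

theorem JoinedIn.exists_sublevel_lt {X : Type*} [TopologicalSpace X] {f : X → ℝ} {p q : X} {c : ℝ}
    (hf : Continuous f) (h : JoinedIn {x | f x < c} p q) :
    ∃ c' < c, JoinedIn {x | f x < c'} p q := by
  obtain ⟨γ, hγ⟩ := h
  obtain ⟨t, -, ht⟩ := isCompact_univ.exists_isMaxOn univ_nonempty
    (hf.comp γ.continuous).continuousOn
  obtain ⟨c', h1, h2⟩ := exists_between (show f (γ t) < c from hγ t)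
  exact ⟨c', h2, γ, fun s => lt_of_le_of_lt (ht (mem_univ s)) h1⟩

/-- A sublevel set slightly above a strict local minimum `p` does not join `p` to points of at most
the same height. -/
theorem exists_forall_joinedIn_sublevel_lt {X : Type*} [MetricSpace X] [ProperSpace X]
    {f : X → ℝ} {p q : X} (hf : Continuous f) {r : ℝ} (hr : 0 < r)
    (hmin : ∀ y ∈ ball p r, y ≠ p → f p < f y) (hne : q ≠ p) (hq : f q ≤ f p) :
    ∃ b > f p, ∀ c, JoinedIn {x | f x < c} p q → b < c := by
  have hrq : r ≤ dist q p := by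
    by_contra! hlt
    exact absurd (hmin q hlt hne) (not_lt.2 hq)
  have hr2 : 0 < r / 2 := half_pos hr
  have hcross : ∀ c, JoinedIn {x | f x < c} p q → ∃ x ∈ sphere p (r / 2), f x < c := by
    rintro c ⟨γ, hγ⟩
    have hmem : r / 2 ∈ Icc (dist (γ 0) p) (dist (γ 1) p) := by
      simp only [γ.source, γ.target, dist_self]
      exact ⟨hr2.le, by linarith⟩
    obtain ⟨t, ht⟩ := intermediate_value_univ 0 1
      (show Continuous fun t => dist (γ t) p by fun_prop) hmem
    exact ⟨γ t, ht, hγ t⟩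
  rcases (sphere p (r / 2)).eq_empty_or_nonempty with h0 | hsne
  · refine ⟨f p + 1, by linarith, fun c hc => ?_⟩
    obtain ⟨x, hx, -⟩ := hcross c hc
    simp [h0] at hx
  · obtain ⟨x, hx, hxmin⟩ := (isCompact_sphere p (r / 2)).exists_isMinOn hsne hf.continuousOn
    refine ⟨f x, hmin x ?_ ?_, fun c hc => ?_⟩
    · rw [mem_ball, mem_sphere.1 hx]
      exact half_lt_self hr
    · rintro rfl
      rw [mem_sphere, dist_self] at hx
      exact hr2.ne hx
    · obtain ⟨y, hy, hyc⟩ := hcross c hc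
      exact lt_of_le_of_lt (hxmin hy) hyc

section Sublevel

variable {E : Type*} [NormedAddCommGroup E] [NormedSpace ℝ E] {f : E → ℝ} {p q : E} {c : ℝ}

/-- The closure of a path component of `{f < c}` is relatively open in `{f ≤ c}`, provided `f` is
convex near the points at level `c`. -/
theorem isClosed_sublevel_diff_closure_pathComponentIn (hf : Continuous f)
    (hconv : ∀ x, f x = c → ∃ r > 0, ConvexOn ℝ (ball x r) f) (p : E) :
    IsClosed ({x | f x ≤ c} \ closure (pathComponentIn {x | f x < c} p)) := by
  set S : Set E := {x | f x < c} with hS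
  have hSo : IsOpen S := isOpen_lt hf continuous_const
  have hadj : ∀ {x : E} {N : Set E}, x ∈ closure (pathComponentIn S p) → N ∈ 𝓝 x →
      ∃ z ∈ N, JoinedIn S p z := fun hx hN => mem_closure_iff_nhds.1 hx _ hN
  refine isClosed_of_closure_subset fun x hx => ?_
  have hxc : f x ≤ c :=
    closure_minimal sdiff_subset (isClosed_le hf continuous_const) hx
  refine ⟨hxc, fun hxU => ?_⟩
  -- It suffices to find a neighbourhood of `x` on which `f ≤ c` forces membership in the closure.
  suffices ∃ N ∈ 𝓝 x, ∀ y ∈ N, f y ≤ c → y ∈ closure (pathComponentIn S p) by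
    obtain ⟨N, hN, h⟩ := this
    obtain ⟨y, hyN, hyc, hy⟩ := mem_closure_iff_nhds.1 hx N hN
    exact hy (h y hyN hyc)
  rcases hxc.lt_or_eq with hlt | heq
  · have hN := (hSo.pathComponentIn x).mem_nhds (mem_pathComponentIn_self hlt)
    obtain ⟨z, hz, hpz⟩ := hadj hxU hN
    exact ⟨_, hN, fun y hy _ => subset_closure (hpz.trans (hz.symm.trans hy))⟩
  · obtain ⟨r, hr, hcv⟩ := hconv x heq
    refine ⟨ball x r, ball_mem_nhds x hr, fun y hy hyc => ?_⟩
    obtain ⟨z, hz, hpz⟩ := hadj hxU (ball_mem_nhds x hr)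
    have hzc : f z < c := hpz.target_mem
    -- All points of the half-open segment from `z` to `y` lie in the component of `z`.
    have hseg : openSegment ℝ z y ⊆ pathComponentIn S p := by
      rintro w ⟨a, b, ha, hb, hab, rfl⟩
      have hwc : f (a • z + b • y) < c := by
        have h1 := hcv.2 hz hy ha.le hb.le hab
        simp only [smul_eq_mul] at h1
        have h2 : a * f z < a * c := mul_lt_mul_of_pos_left hzc ha
        have h3 : b * f y ≤ b * c := mul_le_mul_of_nonneg_left hyc hb.le
        have h4 : a * c + b * c = c := by rw [← add_mul, hab, one_mul]
        linarith
      have hw : a • z + b • y ∈ ball x r := hcv.1 hz hy ha.le hb.le hab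
      refine hpz.trans (JoinedIn.of_segment_subset ?_)
      exact ((hcv.convex_lt c).segment_subset ⟨hz, hzc⟩ ⟨hw, hwc⟩).trans fun v hv => hv.2
    have hycl : y ∈ closure (openSegment ℝ z y) := by
      rw [closure_openSegment]
      exact right_mem_segment ℝ z y
    exact closure_mono hseg hycl

/-- Being joined inside open sublevel sets passes to the limit from above, at a level where `f` is
locally convex. -/
theorem joinedIn_sublevel_of_forall_gt (hf : Continuous f) (hcpt : ∀ M, IsCompact {x | f x ≤ M})
    (hconv : ∀ x, f x = c → ∃ r > 0, ConvexOn ℝ (ball x r) f) (hp : f p < c) (hq : f q < c)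
    (h : ∀ c' > c, JoinedIn {x | f x < c'} p q) : JoinedIn {x | f x < c} p q := by
  by_contra hpq
  set S : Set E := {x | f x < c} with hS
  have hSo : IsOpen S := isOpen_lt hf continuous_const
  set A : Set E := closure (pathComponentIn S p)
  have hAc : A ⊆ {x | f x ≤ c} := closure_minimal
    (pathComponentIn_subset.trans fun x (hx : f x < c) => hx.le)
    (isClosed_le hf continuous_const)
  have hqA : q ∉ A := fun hqA => by
    obtain ⟨z, hz, hpz⟩ := mem_closure_iff_nhds.1 hqA _
      ((hSo.pathComponentIn q).mem_nhds (mem_pathComponentIn_self hq))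
    exact hpq (JoinedIn.trans hpz (JoinedIn.symm hz))
  have hB := isClosed_sublevel_diff_closure_pathComponentIn hf hconv p
  obtain ⟨O₁, O₂, ho₁, ho₂, hA₁, hB₂, hdisj⟩ := SeparatedNhds.of_isCompact_isCompact
    ((hcpt c).of_isClosed_subset isClosed_closure hAc)
    ((hcpt c).of_isClosed_subset hB sdiff_subset) disjoint_sdiff_right
  -- By compactness the two neighbourhoods still cover a slightly higher sublevel set.
  obtain ⟨c', hc', hcov⟩ : ∃ c' > c, {x | f x < c'} ⊆ O₁ ∪ O₂ := by
    have hK : IsCompact ({x | f x ≤ c + 1} \ (O₁ ∪ O₂)) := (hcpt (c + 1)).diff (ho₁.union ho₂)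
    have hKc : ∀ x ∈ {x | f x ≤ c + 1} \ (O₁ ∪ O₂), c < f x := fun x hx => by
      by_contra! hle
      by_cases hxA : x ∈ A
      · exact hx.2 (Or.inl (hA₁ hxA))
      · exact hx.2 (Or.inr (hB₂ ⟨hle, hxA⟩))
    obtain ⟨m, hm, hKm⟩ : ∃ m > c, ∀ x ∈ {x | f x ≤ c + 1} \ (O₁ ∪ O₂), m ≤ f x := by
      rcases ({x | f x ≤ c + 1} \ (O₁ ∪ O₂)).eq_empty_or_nonempty with h0 | hne
      · exact ⟨c + 1, by linarith, by simp [h0]⟩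
      · obtain ⟨x, hx, hmin⟩ := hK.exists_isMinOn hne hf.continuousOn
        exact ⟨f x, hKc x hx, fun y hy => hmin hy⟩
    refine ⟨min m (c + 1), lt_min hm (by linarith), fun x (hx : f x < _) => ?_⟩
    by_contra hxO
    exact absurd (hKm x ⟨(hx.trans_le (min_le_right _ _)).le, hxO⟩)
      (not_le.2 (hx.trans_le (min_le_left _ _)))
  obtain ⟨γ, hγ⟩ := h c' hc'
  have hpre : IsPreconnected (range γ) := isPreconnected_range γ.continuous
  obtain ⟨x, -, hx₁, hx₂⟩ := hpre O₁ O₂ ho₁ ho₂ (range_subset_iff.2 fun t => hcov (hγ t))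
    ⟨p, ⟨0, γ.source⟩, hA₁ (subset_closure (mem_pathComponentIn_self hp))⟩
    ⟨q, ⟨1, γ.target⟩, hB₂ ⟨hq.le, hqA⟩⟩
  exact disjoint_left.1 hdisj hx₁ hx₂

/-- Mountain pass principle for locally convex level sets: a function with compact sublevel sets
that is locally convex at all points higher than `p` has no point other than `p` at most as high as
a strict local minimum `p`. -/
theorem lt_of_strict_local_min_of_locally_convex_above [ProperSpace E] (hf : Continuous f)
    (hcpt : ∀ M, IsCompact {x | f x ≤ M})
    (hconv : ∀ x, f p < f x → ∃ r > 0, ConvexOn ℝ (ball x r) f)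
    {r : ℝ} (hr : 0 < r) (hmin : ∀ y ∈ ball p r, y ≠ p → f p < f y) (hne : q ≠ p) :
    f p < f q := by
  by_contra! hq
  obtain ⟨b, hb, hbT⟩ := exists_forall_joinedIn_sublevel_lt hf hr hmin hne hq
  set T : Set ℝ := {c | JoinedIn {x | f x < c} p q} with hT
  have hTne : T.Nonempty := by
    obtain ⟨M, hM⟩ := ((isCompact_univ (X := unitInterval)).image
      (hf.comp (PathConnectedSpace.somePath p q).continuous)).bddAbove
    exact ⟨M + 1, PathConnectedSpace.somePath p q, fun t =>
      lt_of_le_of_lt (hM ⟨t, mem_univ t, rfl⟩) (lt_add_one M)⟩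
  have hTbdd : BddBelow T := ⟨b, fun c hc => (hbT c hc).le⟩
  have hbc : b ≤ sInf T := le_csInf hTne fun c hc => (hbT c hc).le
  have hgt : ∀ c' > sInf T, JoinedIn {x | f x < c'} p q := fun c' hc' => by
    obtain ⟨c, hc, hcc'⟩ := exists_lt_of_csInf_lt hTne hc'
    exact JoinedIn.mono hc fun x (hx : f x < c) => hx.trans hcc'
  have hmem : JoinedIn {x | f x < sInf T} p q :=
    joinedIn_sublevel_of_forall_gt hf hcpt
      (fun x hx => hconv x (by rw [hx]; exact hb.trans_le hbc))
      (hb.trans_le hbc) (hq.trans_lt (hb.trans_le hbc)) hgt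
  obtain ⟨c', hc', hj⟩ := hmem.exists_sublevel_lt hf
  exact absurd (csInf_le hTbdd hj) (not_le.2 hc')

end Sublevel

/-! ### Strict convexity from the second derivative -/

section Convexity

variable {E : Type*} [NormedAddCommGroup E] [NormedSpace ℝ E] {f : E → ℝ}

theorem strictConvexOn_of_fderiv_fderiv_pos (hf : ContDiff ℝ 2 f) {s : Set E} (hs : Convex ℝ s)
    (hpos : ∀ x ∈ s, ∀ v ≠ 0, 0 < fderiv ℝ (fderiv ℝ f) x v v) : StrictConvexOn ℝ s f := by
  refine ⟨hs, fun x hx y hy hxy a b ha hb hab => ?_⟩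
  have hv : y - x ≠ 0 := sub_ne_zero.2 hxy.symm
  have hline : ∀ t : ℝ, HasDerivAt (fun t : ℝ => x + t • (y - x)) (y - x) t := fun t => by
    simpa using ((hasDerivAt_id t).smul_const (y - x)).const_add x
  have hd1 : Differentiable ℝ f := hf.differentiable (by norm_num)
  have hd2 : Differentiable ℝ (fderiv ℝ f) :=
    (hf.fderiv_right (m := 1) (by norm_num)).differentiable (by norm_num)
  have h1 : ∀ t : ℝ, HasDerivAt (fun t : ℝ => f (x + t • (y - x)))
      (fderiv ℝ f (x + t • (y - x)) (y - x)) t := fun t =>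
    (hd1 _).hasFDerivAt.comp_hasDerivAt t (hline t)
  have h2 : ∀ t : ℝ, HasDerivAt (fun t : ℝ => fderiv ℝ f (x + t • (y - x)) (y - x))
      (fderiv ℝ (fderiv ℝ f) (x + t • (y - x)) (y - x) (y - x)) t := fun t => by
    simpa using ((hd2 _).hasFDerivAt.comp_hasDerivAt t (hline t)).clm_apply
      (hasDerivAt_const t (y - x))
  have hg : StrictConvexOn ℝ (Icc (0 : ℝ) 1) fun t : ℝ => f (x + t • (y - x)) := by
    refine strictConvexOn_of_deriv2_pos' (convex_Icc 0 1)
      (fun t _ => (h1 t).continuousAt.continuousWithinAt) fun t ht => ?_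
    have hderiv : deriv (fun t : ℝ => f (x + t • (y - x))) =
        fun t => fderiv ℝ f (x + t • (y - x)) (y - x) := funext fun t => (h1 t).deriv
    rw [Function.iterate_succ, Function.iterate_one, Function.comp_apply, hderiv, (h2 t).deriv]
    exact hpos _ (hs.add_smul_sub_mem hx hy ht) _ hv
  have key := hg.2 (left_mem_Icc.2 zero_le_one) (right_mem_Icc.2 zero_le_one) zero_ne_one ha hb hab
  have hpt : x + b • (y - x) = a • x + b • y := by
    rw [← eq_sub_iff_add_eq] at hab
    subst hab
    module
  simpa [hpt] using key

theorem StrictConvexOn.lt_of_fderiv_eq_zero {s : Set E} (hs : StrictConvexOn ℝ s f) {p y : E}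
    (hd : DifferentiableAt ℝ f p) (hp : p ∈ s) (hcrit : fderiv ℝ f p = 0) (hy : y ∈ s)
    (hne : y ≠ p) : f p < f y := by
  have hle : ∀ z ∈ s, f p ≤ f z := fun z hz => by
    have hconv : ConvexOn ℝ (Icc (0 : ℝ) 1) (f ∘ AffineMap.lineMap (k := ℝ) p z) :=
      (hs.convexOn.comp_affineMap _).subset (fun t ht => hs.1.lineMap_mem hp hz ht)
        (convex_Icc 0 1)
    have hder : HasDerivAt (f ∘ AffineMap.lineMap (k := ℝ) p z) 0 0 := by
      have h0 : HasFDerivAt f (0 : E →L[ℝ] ℝ) (AffineMap.lineMap (k := ℝ) p z (0 : ℝ)) := by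
        rw [AffineMap.lineMap_apply_zero, ← hcrit]
        exact hd.hasFDerivAt
      simpa using h0.comp_hasDerivAt (0 : ℝ) AffineMap.hasDerivAt_lineMap
    have := hconv.le_slope_of_hasDerivAt (left_mem_Icc.2 zero_le_one)
      (right_mem_Icc.2 zero_le_one) zero_lt_one hder
    simpa [slope_def_field] using this
  have hmid := hs.2 hp hy hne.symm (half_pos one_pos) (half_pos one_pos) (add_halves (1 : ℝ))
  have := hle _ (hs.1 hp hy (half_pos one_pos).le (half_pos one_pos).le (add_halves (1 : ℝ)))
  simp only [smul_eq_mul] at hmid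
  linarith

end Convexity

/-! ### The Hessian matrix and the second derivative -/

section Hessian

variable {n : ℕ} {f : EuclideanSpace ℝ (Fin n) → ℝ}

theorem hessianMatrix_apply (hf : ContDiff ℝ 2 f) (x : EuclideanSpace ℝ (Fin n)) (i j : Fin n) :
    hessianMatrix f x i j = fderiv ℝ (fderiv ℝ f) x (EuclideanSpace.single i 1)
      (EuclideanSpace.single j 1) := by
  have hd2 : Differentiable ℝ (fderiv ℝ f) :=
    (hf.fderiv_right (m := 1) (by norm_num)).differentiable (by norm_num)
  have h := (hd2 x).hasFDerivAt.clm_apply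
    (hasFDerivAt_const (EuclideanSpace.single j (1 : ℝ)) x)
  simp [hessianMatrix, h.fderiv]

theorem dotProduct_hessianMatrix_mulVec (hf : ContDiff ℝ 2 f) (x v : EuclideanSpace ℝ (Fin n)) :
    v.ofLp ⬝ᵥ (hessianMatrix f x).mulVec v.ofLp = fderiv ℝ (fderiv ℝ f) x v v := by
  have hv : v = ∑ i, v i • EuclideanSpace.single i (1 : ℝ) := by
    simpa using ((EuclideanSpace.basisFun (Fin n) ℝ).sum_repr v).symm
  conv_rhs => rw [hv]
  simp only [map_sum, map_smul, _root_.sum_apply, _root_.smul_apply,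
    dotProduct, Matrix.mulVec, hessianMatrix_apply hf, Finset.mul_sum, smul_eq_mul]
  rw [Finset.sum_comm]
  refine Finset.sum_congr rfl fun i _ => Finset.sum_congr rfl fun j _ => ?_
  ring

theorem mem_hessPos_iff (hf : ContDiff ℝ 2 f) {x : EuclideanSpace ℝ (Fin n)} :
    x ∈ hessPos f ↔ ∀ v ≠ 0, 0 < fderiv ℝ (fderiv ℝ f) x v v := by
  refine Matrix.posDef_iff_dotProduct_mulVec.trans ⟨fun h v hv => ?_, fun h => ⟨?_, fun v hv => ?_⟩⟩
  · rw [← dotProduct_hessianMatrix_mulVec hf]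
    simpa using h.2 (x := v.ofLp) (by simpa using hv)
  · ext i j
    have hsymm : IsSymmSndFDerivAt ℝ f x := hf.contDiffAt.isSymmSndFDerivAt (by simp)
    simp [hessianMatrix_apply hf, hsymm.eq (EuclideanSpace.single i 1)]
  · have := h (WithLp.toLp 2 v) (by simpa using hv)
    rw [← dotProduct_hessianMatrix_mulVec hf] at this
    simpa using this

theorem isOpen_hessPos (hf : ContDiff ℝ 2 f) : IsOpen (hessPos f) := by
  have hcont : Continuous (fderiv ℝ (fderiv ℝ f)) :=
    (hf.fderiv_right (m := 1) (by norm_num)).continuous_fderiv (by norm_num)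
  refine isOpen_iff_mem_nhds.2 fun x hx => ?_
  -- Positivity on the compact unit sphere is an open condition, and it gives positivity on all
  -- nonzero vectors by homogeneity.
  have hev : ∀ᶠ y in 𝓝 x, ∀ v ∈ sphere (0 : EuclideanSpace ℝ (Fin n)) 1,
      0 < fderiv ℝ (fderiv ℝ f) y v v := by
    refine (isCompact_sphere _ _).eventually_forall_of_forall_eventually fun v hv => ?_
    have hc : Continuous fun z : EuclideanSpace ℝ (Fin n) × EuclideanSpace ℝ (Fin n) =>
        fderiv ℝ (fderiv ℝ f) z.1 z.2 z.2 := by fun_prop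
    exact hc.continuousAt.eventually_const_lt
      ((mem_hessPos_iff hf).1 hx v (ne_zero_of_mem_unit_sphere ⟨v, hv⟩))
  filter_upwards [hev] with y hy
  refine (mem_hessPos_iff hf).2 fun v hv => ?_
  have hn : 0 < ‖v‖ := norm_pos_iff.2 hv
  have h := hy (‖v‖⁻¹ • v) (by simp [norm_smul, hn.ne'])
  simp only [map_smul, _root_.smul_apply, smul_eq_mul] at h
  have hi : 0 < ‖v‖⁻¹ := inv_pos.2 hn
  exact pos_of_mul_pos_right (pos_of_mul_pos_right h hi.le) hi.le

theorem exists_strictConvexOn_ball_of_mem_hessPos (hf : ContDiff ℝ 2 f)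
    {x : EuclideanSpace ℝ (Fin n)} (hx : x ∈ hessPos f) :
    ∃ r > 0, StrictConvexOn ℝ (ball x r) f := by
  obtain ⟨r, hr, hsub⟩ := Metric.isOpen_iff.1 (isOpen_hessPos hf) x hx
  exact ⟨r, hr, strictConvexOn_of_fderiv_fderiv_pos hf (convex_ball x r)
    fun y hy => (mem_hessPos_iff hf).1 (hsub hy)⟩

theorem isClosed_criticalSet (hf : ContDiff ℝ 2 f) : IsClosed (criticalSet f) :=
  isClosed_eq (hf.continuous_fderiv (by norm_num)) continuous_const

theorem NormCoercive.tendsto_cocompact (hcoer : NormCoercive f) :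
    Tendsto f (cocompact (EuclideanSpace ℝ (Fin n))) atTop := by
  rwa [NormCoercive, comap_norm_atTop, Metric.cobounded_eq_cocompact] at hcoer

theorem NormCoercive.isCompact_sublevel (hcoer : NormCoercive f) (hf : Continuous f) (M : ℝ) :
    IsCompact {x | f x ≤ M} := by
  obtain ⟨K, hK, hsub⟩ := mem_cocompact.1 (hcoer.tendsto_cocompact.eventually_gt_atTop M)
  refine hK.of_isClosed_subset (isClosed_le hf continuous_const) fun x (hx : f x ≤ M) => ?_
  by_contra hxK
  exact absurd (hsub hxK) (not_lt.2 hx)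

theorem NormCoercive.criticalSet_nonempty (hcoer : NormCoercive f) (hf : Continuous f) :
    (criticalSet f).Nonempty := by
  obtain ⟨x, hx⟩ := hf.exists_forall_le hcoer.tendsto_cocompact
  exact ⟨x, (isMinOn_univ_iff.2 hx).isLocalMin univ_mem |>.fderiv_eq_zero⟩

end Hessian

end

theorem proposition3p1 (n : ℕ) (f : EuclideanSpace ℝ (Fin n) → ℝ)
    (hcoer : NormCoercive f) (hf : ContDiff ℝ 2 f)
    (hHess_bdd : Bornology.IsBounded (hessPos f)ᶜ) (hHess_ne : (hessPos f)ᶜ.Nonempty)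
    (hC_bdd : Bornology.IsBounded (criticalSet f)) :
    IsGreatest (f '' (hessPos f)ᶜ) (hMax f) ∧
    IsGreatest (f '' criticalSet f) (nuMax f) ∧
    hMax f ≥ nuMax f := by
  have hfc : Continuous f := hf.continuous
  have hH : IsGreatest (f '' (hessPos f)ᶜ) (hMax f) :=
    ((Metric.isCompact_of_isClosed_isBounded (isOpen_hessPos hf).isClosed_compl hHess_bdd).image
      hfc).isGreatest_sSup (hHess_ne.image f)
  have hC : IsGreatest (f '' criticalSet f) (nuMax f) :=
    ((Metric.isCompact_of_isClosed_isBounded (isClosed_criticalSet hf) hC_bdd).image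
      hfc).isGreatest_sSup ((hcoer.criticalSet_nonempty hfc).image f)
  refine ⟨hH, hC, ?_⟩
  by_contra! hlt
  obtain ⟨p, hp, hpν⟩ := hC.1
  obtain ⟨q, hq⟩ := hHess_ne
  have habove : ∀ x, hMax f < f x → x ∈ hessPos f := fun x hx => by
    by_contra hxH
    exact absurd (hH.2 ⟨x, hxH, rfl⟩) (not_le.2 hx)
  have hhp : hMax f < f p := by rwa [hpν]
  have hqp : f q < f p := (hH.2 ⟨q, hq, rfl⟩).trans_lt hhp
  obtain ⟨r, hr, hconv⟩ := exists_strictConvexOn_ball_of_mem_hessPos hf (habove p hhp)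
  refine hqp.not_gt (lt_of_strict_local_min_of_locally_convex_above hfc
    (hcoer.isCompact_sublevel hfc) (fun x hx => ?_) hr (fun y hy hne => ?_) fun h => ?_)
  · obtain ⟨ρ, hρ, hcx⟩ := exists_strictConvexOn_ball_of_mem_hessPos hf (habove x (hhp.trans hx))
    exact ⟨ρ, hρ, hcx.convexOn⟩
  · exact hconv.lt_of_fderiv_eq_zero (hf.differentiable (by norm_num) p)
      (Metric.mem_ball_self hr) hp hy hne
  · rw [h] at hqp
    exact hqp.false
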